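/- **Theorem 1.** A line transversal to a family of sets in $\mathbb{R}^d$ is a straight line that intersects every member of the family. For every $d \ge 3$ there is a finite family of pairwise disjoint congruent closed balls (of positive radius) in $\mathbb{R}^d$ that has no line transversal, although every subfamily of size at most $2d-2$ has a line transversal. Hence the Helly number for line transversals to disjoint unit balls in $\mathbb{R}^d$, that is, the least $h \in \{0,1,2,\dots\}\cup\{\infty\}$ such that every family of pairwise disjoint closed unit balls in $\mathbb{R}^d$ all of whose subfamilies of size at most $h$ have a line transversal has a line transversal itself, is at least $2d-1$. -/

import Mathlib

/-- The line `L` (a one-dimensional affine subspace, automatically nonempty) is a line transversal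
to the family `F`: it meets every member of `F`. -/
def IsLineTransversal {d : ℕ} (L : AffineSubspace ℝ (EuclideanSpace ℝ (Fin d)))
    (F : Set (Set (EuclideanSpace ℝ (Fin d)))) : Prop :=
  Module.finrank ℝ L.direction = 1 ∧ ∀ B ∈ F, ((L : Set (EuclideanSpace ℝ (Fin d))) ∩ B).Nonempty

/-- The family `F` has a line transversal. -/
def HasLineTransversal {d : ℕ} (F : Set (Set (EuclideanSpace ℝ (Fin d)))) : Prop :=
  ∃ L : AffineSubspace ℝ (EuclideanSpace ℝ (Fin d)), IsLineTransversal L F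

/-- `F` is a family of pairwise disjoint closed balls of radius `r` in `ℝ^d`. -/
def IsDisjointBallFamily {d : ℕ} (r : ℝ) (F : Set (Set (EuclideanSpace ℝ (Fin d)))) : Prop :=
  (∀ B ∈ F, ∃ c : EuclideanSpace ℝ (Fin d), B = Metric.closedBall c r) ∧ F.PairwiseDisjoint id

/-- The Helly number for line transversals to disjoint unit balls in `ℝ^d`: the least `h` such that
a family of pairwise disjoint unit balls has a line transversal as soon as each of its subfamilies
of size at most `h` has one. It is `⊤` if no finite `h` has this property. -/
noncomputable def lineTransversalHellyNumber (d : ℕ) : ℕ∞ :=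
  sInf {h : ℕ∞ | ∀ F : Set (Set (EuclideanSpace ℝ (Fin d))), IsDisjointBallFamily 1 F →
    (∀ G ⊆ F, G.encard ≤ h → HasLineTransversal G) → HasLineTransversal F}

/-! Put `m = d - 1` and place `2m+1` unit balls tangent to the vertical axis: two in each direction
`e_j`, at opposite heights, and one at height 0 in direction `-(1,…,1)`. To first order, moving the
axis to `p + s • v` enters the ball at height `s` with offset `c` iff `⟪c, p + s • v⟫ > 0`. The
pairs force every `p_j > 0` and the last ball forces `∑ p_j < 0`, yet any `2m` of these conditions
are compatible (`exists_slope_inner_pos`). A quadratic estimate, `norm_sq_sub_lt_two_inner`, extends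
the obstruction to all non-horizontal lines. So no line meets all the open balls, while any `2m`
share a transversal; slightly smaller closed balls then exclude the axis too. -/

open Filter Topology

/-! ### Height and horizontal coordinates -/

section CylinderCoordinates

variable {m : ℕ}

/-- The point of `ℝ^(m+1)` with height `t` above the point `x` of `ℝ^m`. -/
noncomputable def liftAt (t : ℝ) (x : EuclideanSpace ℝ (Fin m)) :
    EuclideanSpace ℝ (Fin (m + 1)) :=
  WithLp.toLp 2 (Fin.cons t x.ofLp)

/-- The projection of `ℝ^(m+1)` to `ℝ^m` that forgets the height. -/
noncomputable def dropHeight (y : EuclideanSpace ℝ (Fin (m + 1))) : EuclideanSpace ℝ (Fin m) :=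
  WithLp.toLp 2 (Fin.tail y.ofLp)

lemma liftAt_dropHeight (y : EuclideanSpace ℝ (Fin (m + 1))) :
    liftAt (y 0) (dropHeight y) = y := by
  ext i
  refine Fin.cases ?_ (fun j => ?_) i <;> simp [liftAt, dropHeight]

lemma liftAt_sub (s t : ℝ) (x y : EuclideanSpace ℝ (Fin m)) :
    liftAt s x - liftAt t y = liftAt (s - t) (x - y) := by
  ext i
  refine Fin.cases ?_ (fun j => ?_) i <;> simp [liftAt]

lemma liftAt_add (s t : ℝ) (x y : EuclideanSpace ℝ (Fin m)) :
    liftAt s x + liftAt t y = liftAt (s + t) (x + y) := by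
  ext i
  refine Fin.cases ?_ (fun j => ?_) i <;> simp [liftAt]

lemma smul_liftAt (a t : ℝ) (x : EuclideanSpace ℝ (Fin m)) :
    a • liftAt t x = liftAt (a * t) (a • x) := by
  ext i
  refine Fin.cases ?_ (fun j => ?_) i <;> simp [liftAt]

lemma norm_liftAt_sq (t : ℝ) (x : EuclideanSpace ℝ (Fin m)) :
    ‖liftAt t x‖ ^ 2 = t ^ 2 + ‖x‖ ^ 2 := by
  simp [EuclideanSpace.norm_sq_eq, Fin.sum_univ_succ, liftAt]

lemma abs_le_norm_liftAt (t : ℝ) (x : EuclideanSpace ℝ (Fin m)) : |t| ≤ ‖liftAt t x‖ := by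
  refine abs_le_of_sq_le_sq ?_ (norm_nonneg _)
  rw [norm_liftAt_sq]
  nlinarith [sq_nonneg ‖x‖]

end CylinderCoordinates

/-- If the line of slope `v` through `p` meets the open unit ball centred at height `h` over the
unit vector `c`, then its point at height `h` satisfies a second-order tangency inequality. -/
lemma norm_sq_sub_lt_two_inner {E : Type*} [NormedAddCommGroup E] [InnerProductSpace ℝ E]
    {c v x : E} {τ : ℝ} (hc : ‖c‖ = 1) (h : τ ^ 2 + ‖x + τ • v - c‖ ^ 2 < 1) :
    ‖x‖ ^ 2 - ‖v‖ ^ 2 < 2 * inner ℝ c x := by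
  have h1 : ‖x - c‖ ≤ ‖x + τ • v - c‖ + |τ| * ‖v‖ := by
    have : x - c = (x + τ • v - c) - τ • v := by abel
    calc ‖x - c‖ = ‖(x + τ • v - c) - τ • v‖ := by rw [← this]
      _ ≤ _ := by simpa [norm_smul] using norm_sub_le (x + τ • v - c) (τ • v)
  have h2 : ‖x - c‖ ^ 2 = ‖x‖ ^ 2 - 2 * inner ℝ c x + 1 := by
    rw [norm_sub_sq_real, hc, real_inner_comm]; ring
  set a := ‖x + τ • v - c‖
  have h3 : ‖x - c‖ ^ 2 ≤ (a + |τ| * ‖v‖) ^ 2 := by gcongr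
  -- Cauchy–Schwarz for `(a, |τ|)` and `(1, ‖v‖)`.
  have h4 : (a + |τ| * ‖v‖) ^ 2 ≤ (τ ^ 2 + a ^ 2) * (1 + ‖v‖ ^ 2) := by
    rw [← sq_abs τ]; nlinarith [sq_nonneg (|τ| - a * ‖v‖)]
  have h5 : (τ ^ 2 + a ^ 2) * (1 + ‖v‖ ^ 2) < 1 * (1 + ‖v‖ ^ 2) := by gcongr
  linarith

/-! ### Balls pinning the vertical axis -/

section Configuration

variable (m : ℕ)

/-- Heights of the `2m+1` centres. -/
noncomputable def centerHeight : Option (Fin m × Bool) → ℝ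
  | none => 0
  | some (j, true) => 3 * ((j : ℝ) + 1)
  | some (j, false) => -(3 * ((j : ℝ) + 1))

/-- Horizontal positions of the `2m+1` centres. -/
noncomputable def centerOffset : Option (Fin m × Bool) → EuclideanSpace ℝ (Fin m)
  | none => -((√m)⁻¹ • WithLp.toLp 2 (fun _ => (1 : ℝ)))
  | some (j, _) => EuclideanSpace.single j 1

/-- Centres of `2m+1` unit balls that are tangent to the vertical axis. -/
noncomputable def pinningCenter (i : Option (Fin m × Bool)) : EuclideanSpace ℝ (Fin (m + 1)) :=
  liftAt (centerHeight m i) (centerOffset m i)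

variable {m}

lemma norm_centerOffset (hm : 0 < m) (i : Option (Fin m × Bool)) : ‖centerOffset m i‖ = 1 := by
  rcases i with _ | ⟨j, b⟩
  · have : (0 : ℝ) < √m := Real.sqrt_pos.2 (by exact_mod_cast hm)
    simp only [centerOffset, norm_neg, norm_smul]
    rw [EuclideanSpace.norm_eq]
    simp [abs_of_pos this, this.ne']
  · simp [centerOffset]

lemma inner_centerOffset_none (x : EuclideanSpace ℝ (Fin m)) :
    inner ℝ (centerOffset m none) x = -((√m)⁻¹ * ∑ j, x j) := by
  simp [centerOffset, inner_smul_left, PiLp.inner_apply]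

lemma inner_centerOffset_some (j : Fin m) (b : Bool) (x : EuclideanSpace ℝ (Fin m)) :
    inner ℝ (centerOffset m (some (j, b))) x = x j := by
  simp [centerOffset, EuclideanSpace.inner_single_left]

lemma three_le_abs_centerHeight_sub {i k : Option (Fin m × Bool)} (h : i ≠ k) :
    3 ≤ |centerHeight m i - centerHeight m k| := by
  have key : ∀ a b : ℤ, a ≠ b → (3 : ℝ) ≤ |3 * (a : ℝ) - 3 * (b : ℝ)| := by
    intro a b hab
    have h1 : (1 : ℝ) ≤ |(a : ℝ) - b| := by
      exact_mod_cast Int.one_le_abs (sub_ne_zero.2 hab)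
    rw [← mul_sub, abs_mul, abs_of_pos (by norm_num : (0 : ℝ) < 3)]
    linarith
  let n : Option (Fin m × Bool) → ℤ
    | none => 0
    | some (j, true) => (j : ℤ) + 1
    | some (j, false) => -((j : ℤ) + 1)
  have hn : ∀ i, centerHeight m i = 3 * (n i : ℝ) := by
    rintro (_ | ⟨j, _ | _⟩) <;> simp [centerHeight, n]
    ring
  rw [hn, hn]
  refine key _ _ fun e => h ?_
  rcases i with _ | ⟨i, _ | _⟩ <;> rcases k with _ | ⟨k, _ | _⟩ <;>
    simp only [n, Option.some.injEq, Prod.mk.injEq, Fin.ext_iff, and_true, reduceCtorEq] at e ⊢ <;>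
    omega

lemma two_lt_dist_pinningCenter {i k : Option (Fin m × Bool)} (h : i ≠ k) :
    2 < dist (pinningCenter m i) (pinningCenter m k) := by
  rw [dist_eq_norm, pinningCenter, pinningCenter, liftAt_sub]
  linarith [three_le_abs_centerHeight_sub h, abs_le_norm_liftAt
    (centerHeight m i - centerHeight m k) (centerOffset m i - centerOffset m k)]

/-- A line that is not horizontal misses one of the open unit balls. -/
lemma not_forall_graph_dist_pinningCenter_lt (hm : 0 < m) (p v : EuclideanSpace ℝ (Fin m))
    (t : Option (Fin m × Bool) → ℝ) :
    ¬ ∀ i, dist (liftAt (t i) (p + t i • v)) (pinningCenter m i) < 1 := by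
  intro H
  have key : ∀ i, ‖p + centerHeight m i • v‖ ^ 2 - ‖v‖ ^ 2 <
      2 * inner ℝ (centerOffset m i) (p + centerHeight m i • v) := by
    intro i
    refine norm_sq_sub_lt_two_inner (τ := t i - centerHeight m i) (norm_centerOffset hm i) ?_
    have h1 := H i
    rw [dist_eq_norm, pinningCenter, liftAt_sub] at h1
    have h2 := norm_liftAt_sq (t i - centerHeight m i) (p + t i • v - centerOffset m i)
    have h3 : p + centerHeight m i • v + (t i - centerHeight m i) • v - centerOffset m i =
        p + t i • v - centerOffset m i := by module
    rw [h3, ← h2]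
    exact pow_lt_one₀ (norm_nonneg _) h1 two_ne_zero
  -- Adding the inequalities at heights `±s` cancels the terms linear in `v`; the 8 is `3² - 1`,
  -- since `s ≥ 3`.
  have hpos : ∀ j : Fin m, ‖p‖ ^ 2 + 8 * ‖v‖ ^ 2 < 2 * p j := by
    intro j
    have h1 := key (some (j, true))
    have h2 := key (some (j, false))
    rw [inner_centerOffset_some] at h1 h2
    simp only [centerHeight, PiLp.add_apply, PiLp.smul_apply, smul_eq_mul] at h1 h2
    set s : ℝ := 3 * ((j : ℝ) + 1) with hs
    have hs3 : 3 ≤ s := by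
      have : (0 : ℝ) ≤ j := Nat.cast_nonneg _
      linarith
    rw [norm_add_sq_real, inner_smul_right, norm_smul, mul_pow, Real.norm_eq_abs, sq_abs]
      at h1 h2
    have : 9 * ‖v‖ ^ 2 ≤ s ^ 2 * ‖v‖ ^ 2 := by gcongr; nlinarith
    nlinarith
  have hnone := key none
  rw [inner_centerOffset_none] at hnone
  simp only [centerHeight, zero_smul, add_zero] at hnone
  have hsum : m * (‖p‖ ^ 2 + 8 * ‖v‖ ^ 2) ≤ 2 * ∑ j, p j := by
    rw [Finset.mul_sum]
    simpa [mul_add] using Finset.sum_le_sum fun j (_ : j ∈ Finset.univ) => (hpos j).le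
  have hm1 : (1 : ℝ) ≤ √m := Real.one_le_sqrt.2 (by exact_mod_cast hm)
  have hmm : (√m)⁻¹ * (m : ℝ) = √m := by
    rw [inv_mul_eq_div, Real.div_sqrt]
  have h1 := mul_le_mul_of_nonneg_left hsum (inv_nonneg.2 (zero_le_one.trans hm1))
  rw [← mul_assoc, hmm] at h1
  have h2 : ‖p‖ ^ 2 + 8 * ‖v‖ ^ 2 ≤ √m * (‖p‖ ^ 2 + 8 * ‖v‖ ^ 2) :=
    le_mul_of_one_le_left (by positivity) hm1
  nlinarith [sq_nonneg ‖p‖, sq_nonneg ‖v‖]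

lemma not_forall_dist_pinningCenter_lt (hm : 0 < m) (P u : EuclideanSpace ℝ (Fin (m + 1)))
    (t : Option (Fin m × Bool) → ℝ) :
    ¬ ∀ i, dist (P + t i • u) (pinningCenter m i) < 1 := by
  intro H
  have hP := liftAt_dropHeight P
  have hu := liftAt_dropHeight u
  set p := dropHeight P
  set w := dropHeight u
  rw [← hP, ← hu] at H
  by_cases h0 : u 0 = 0
  · have hh : ∀ i, |P 0 - centerHeight m i| < 1 := by
      intro i
      have := H i
      rw [smul_liftAt, liftAt_add, dist_eq_norm, pinningCenter, liftAt_sub, h0, mul_zero,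
        add_zero] at this
      exact (abs_le_norm_liftAt _ _).trans_lt this
    have h1 := abs_lt.1 (hh none)
    have h2 := abs_lt.1 (hh (some (⟨0, hm⟩, true)))
    simp only [centerHeight, Nat.cast_zero] at h1 h2
    linarith
  -- Reparametrise the line by height.
  · refine not_forall_graph_dist_pinningCenter_lt hm (p - (P 0 / u 0) • w) ((u 0)⁻¹ • w)
      (fun i => P 0 + t i * u 0) fun i => ?_
    convert H i using 2
    rw [smul_liftAt, liftAt_add]
    congr 1
    rw [smul_smul, add_mul, mul_assoc, mul_inv_cancel₀ h0]
    module

/-- Once a ball is left out, some first-order motion of the axis enters all balls that remain. -/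
lemma exists_slope_inner_pos (hm : 0 < m) (i : Option (Fin m × Bool)) :
    ∃ p v : EuclideanSpace ℝ (Fin m), ∀ k ≠ i,
      0 < inner ℝ (centerOffset m k) (p + centerHeight m k • v) := by
  have hs : 0 < (√m)⁻¹ := inv_pos.2 (Real.sqrt_pos.2 (by exact_mod_cast hm))
  rcases i with _ | ⟨j, b⟩
  · refine ⟨WithLp.toLp 2 fun _ => 1, 0, ?_⟩
    rintro (_ | ⟨k, c⟩) hk
    · exact absurd rfl hk
    · simp [inner_centerOffset_some]
  -- The coordinates of `p` sum to `m - (m+1) = -1`, which suits the ball `none`. The slope changes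
  -- only coordinate `j`, raising it from `-m` to `1` at the height of the omitted ball's partner.
  · refine ⟨WithLp.toLp 2 (fun _ => 1) - EuclideanSpace.single j ((m : ℝ) + 1),
      EuclideanSpace.single j (-((m + 1) / centerHeight m (some (j, b)))), ?_⟩
    have hj : (0 : ℝ) < (j : ℝ) + 1 := by positivity
    rintro (_ | ⟨k, c⟩) hk
    · rw [inner_centerOffset_none]
      simp [centerHeight, hs]
    · rw [inner_centerOffset_some]
      by_cases hkj : k = j
      · subst hkj
        rcases b with _ | _ <;> rcases c with _ | _
        · exact absurd rfl hk
        · simp [centerHeight]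
          field_simp
          linarith
        · simp [centerHeight]
          field_simp
          linarith
        · exact absurd rfl hk
      · simp [hkj]

lemma exists_forall_dist_pinningCenter_lt (hm : 0 < m) (i : Option (Fin m × Bool)) :
    ∃ P u : EuclideanSpace ℝ (Fin (m + 1)), u ≠ 0 ∧
      ∀ k ≠ i, ∃ t : ℝ, dist (P + t • u) (pinningCenter m k) < 1 := by
  obtain ⟨p, v, h⟩ := exists_slope_inner_pos hm i
  -- `‖ε • x - c‖² = 1 - 2ε⟪c, x⟫ + ε²‖x‖²` is below 1 for small `ε > 0`.
  have hev : ∀ᶠ ε : ℝ in 𝓝[>] 0, ∀ k, k ≠ i →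
      ‖ε • (p + centerHeight m k • v) - centerOffset m k‖ < 1 := by
    rw [eventually_all]
    intro k
    by_cases hk : k = i
    · simp [hk]
    set x := p + centerHeight m k • v with hx
    have hpos := h k hk
    have hlim : Tendsto (fun ε : ℝ => ε * ‖x‖ ^ 2) (𝓝[>] 0) (𝓝 0) := by
      have : Continuous fun ε : ℝ => ε * ‖x‖ ^ 2 := by fun_prop
      simpa using (this.tendsto 0).mono_left nhdsWithin_le_nhds
    filter_upwards [hlim.eventually_lt_const hpos, self_mem_nhdsWithin] with ε hε hε0 _
    have hε0 : 0 < ε := hε0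
    rw [← sq_lt_one_iff₀ (norm_nonneg _), norm_sub_sq_real, norm_centerOffset hm, norm_smul,
      mul_pow, Real.norm_eq_abs, sq_abs, inner_smul_left, real_inner_comm]
    simp only [conj_trivial]
    nlinarith [mul_lt_mul_of_pos_left hε hε0, mul_pos hε0 hpos]
  obtain ⟨ε, hε⟩ := hev.exists
  refine ⟨liftAt 0 (ε • p), liftAt 1 (ε • v), fun h0 => ?_, fun k hk => ⟨centerHeight m k, ?_⟩⟩
  · have := abs_le_norm_liftAt 1 (ε • v)
    rw [h0] at this
    norm_num at this
  · have e : liftAt 0 (ε • p) + centerHeight m k • liftAt 1 (ε • v) - pinningCenter m k =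
        liftAt 0 (ε • (p + centerHeight m k • v) - centerOffset m k) := by
      rw [smul_liftAt, liftAt_add, pinningCenter, liftAt_sub]
      congr 1
      · ring
      · module
    rw [dist_eq_norm, e, ← sq_lt_one_iff₀ (norm_nonneg _), norm_liftAt_sq]
    simpa using hε k hk

end Configuration

/-! ### From open balls to closed balls, and the theorem -/

/-- Shrinking the balls slightly, and rescaling to unit radius, makes a family of centres pinned
in the open sense into one without a transversal. -/
lemma exists_centers_without_transversal {m : ℕ} (hm : 0 < m) :
    ∃ D : Option (Fin m × Bool) → EuclideanSpace ℝ (Fin (m + 1)),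
      (∀ i k, i ≠ k → 2 < dist (D i) (D k)) ∧
      (∀ (P u : EuclideanSpace ℝ (Fin (m + 1))) (t : Option (Fin m × Bool) → ℝ),
        ¬ ∀ i, dist (P + t i • u) (D i) ≤ 1) ∧
      ∀ i, ∃ P u : EuclideanSpace ℝ (Fin (m + 1)), u ≠ 0 ∧
        ∀ k ≠ i, ∃ t : ℝ, dist (P + t • u) (D k) ≤ 1 := by
  choose P u hu h using exists_forall_dist_pinningCenter_lt hm
  choose! t ht using h
  -- Finitely many strict inequalities leave room for one common `r < 1`.
  have hev : ∀ᶠ r : ℝ in 𝓝[<] 1, ∀ i k, k ≠ i →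
      dist (P i + t i k • u i) (pinningCenter m k) < r := by
    simp only [eventually_all]
    intro i k hk
    exact (tendsto_id.eventually_const_lt (ht i k hk)).filter_mono nhdsWithin_le_nhds
  have hpos : ∀ᶠ r : ℝ in 𝓝[<] 1, 0 < r :=
    (tendsto_id.eventually_const_lt (zero_lt_one' ℝ)).filter_mono nhdsWithin_le_nhds
  obtain ⟨r, ⟨hr, hr0⟩, hr1⟩ := ((hev.and hpos).and self_mem_nhdsWithin).exists
  have hr1 : r < 1 := hr1
  have hdist : ∀ x y : EuclideanSpace ℝ (Fin (m + 1)),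
      dist (r⁻¹ • x) (r⁻¹ • y) = r⁻¹ * dist x y := by
    intro x y
    rw [dist_smul₀, Real.norm_of_nonneg (inv_nonneg.2 hr0.le)]
  have hinv : 1 < r⁻¹ := (one_lt_inv₀ hr0).2 hr1
  refine ⟨fun i => r⁻¹ • pinningCenter m i, fun i k hik => ?_, fun Q w s H => ?_, fun i =>
    ⟨r⁻¹ • P i, r⁻¹ • u i, smul_ne_zero (inv_ne_zero hr0.ne') (hu i), fun k hk => ⟨t i k, ?_⟩⟩⟩
  · rw [hdist]
    nlinarith [two_lt_dist_pinningCenter hik]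
  · refine not_forall_dist_pinningCenter_lt hm (r • Q) (r • w) s fun i => ?_
    have e : Q + s i • w = r⁻¹ • (r • Q + s i • r • w) := by
      rw [smul_add, smul_comm (s i) r w, inv_smul_smul₀ hr0.ne', inv_smul_smul₀ hr0.ne']
    have h1 := H i
    rw [e, hdist, inv_mul_le_iff₀ hr0, mul_one] at h1
    exact h1.trans_lt hr1
  · rw [smul_comm, ← smul_add, hdist, inv_mul_le_iff₀ hr0, mul_one]
    exact (hr i k hk).le

lemma exists_unitBallFamily_without_transversal {m : ℕ} (hm : 0 < m) :
    ∃ F : Set (Set (EuclideanSpace ℝ (Fin (m + 1)))), F.Finite ∧ IsDisjointBallFamily 1 F ∧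
      ¬ HasLineTransversal F ∧ ∀ G ⊆ F, G.encard ≤ ((2 * m : ℕ) : ℕ∞) → HasLineTransversal G := by
  obtain ⟨D, hD, hno, hyes⟩ := exists_centers_without_transversal hm
  set f : Option (Fin m × Bool) → Set (EuclideanSpace ℝ (Fin (m + 1))) :=
    fun i => Metric.closedBall (D i) 1 with hf
  have hdisj : ∀ i k, i ≠ k → Disjoint (f i) (f k) := fun i k hik =>
    Metric.closedBall_disjoint_closedBall (by linarith [hD i k hik])
  have hinj : Function.Injective f := by
    intro i k hik
    by_contra hne
    have h1 := hdisj i k hne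
    rw [hik, disjoint_self] at h1
    exact (Metric.nonempty_closedBall.2 zero_le_one : (f k).Nonempty).ne_empty h1
  refine ⟨Set.range f, Set.finite_range f, ⟨?_, ?_⟩, ?_, ?_⟩
  · rintro _ ⟨i, rfl⟩
    exact ⟨D i, rfl⟩
  · rintro _ ⟨i, rfl⟩ _ ⟨k, rfl⟩ hik
    exact hdisj i k fun e => hik (e ▸ rfl)
  · rintro ⟨L, hL, hmeet⟩
    choose x hxL hx using fun i => hmeet (f i) ⟨i, rfl⟩
    obtain ⟨u, -, hu⟩ := finrank_eq_one_iff'.1 hL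
    have hline : ∀ i, ∃ c : ℝ, x i = x none + c • (u : EuclideanSpace ℝ (Fin (m + 1))) := by
      intro i
      obtain ⟨c, hc⟩ := hu ⟨x i -ᵥ x none, AffineSubspace.vsub_mem_direction (hxL i) (hxL none)⟩
      refine ⟨c, ?_⟩
      have := congrArg Subtype.val hc
      simp only [SetLike.val_smul, vsub_eq_sub] at this
      rw [this, add_sub_cancel]
    choose t ht using hline
    exact hno (x none) u t fun i => ht i ▸ hx i
  · intro G hG hcard
    -- There are `2m+1` distinct balls, so `G` omits one.
    have hex : ∃ i, f i ∉ G := by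
      by_contra! hall
      have hGF : G = Set.range f := hG.antisymm (Set.range_subset_iff.2 hall)
      rw [hGF, ← Set.image_univ, hinj.encard_image, Set.encard_univ, ENat.card_eq_coe_fintype_card,
        Nat.cast_le] at hcard
      simp at hcard
      omega
    obtain ⟨i, hi⟩ := hex
    obtain ⟨P, u, hu, h⟩ := hyes i
    refine ⟨AffineSubspace.mk' P (Submodule.span ℝ {u}), ?_, fun B hB => ?_⟩
    · rw [AffineSubspace.direction_mk', finrank_span_singleton hu]
    · obtain ⟨k, rfl⟩ := hG hB
      obtain ⟨t, ht⟩ := h k fun e => hi (e ▸ hB)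
      refine ⟨P + t • u, ?_, ht⟩
      rw [SetLike.mem_coe, AffineSubspace.mem_mk', vsub_eq_sub, add_sub_cancel_left]
      exact Submodule.smul_mem _ _ (Submodule.mem_span_singleton_self u)

theorem theorem1 (d : ℕ) (hd : 3 ≤ d) :
    (∃ (r : ℝ) (F : Set (Set (EuclideanSpace ℝ (Fin d)))),
      0 < r ∧ F.Finite ∧ IsDisjointBallFamily r F ∧
      ¬ HasLineTransversal F ∧
      ∀ G ⊆ F, G.encard ≤ ((2 * d - 2 : ℕ) : ℕ∞) → HasLineTransversal G) ∧
    ((2 * d - 1 : ℕ) : ℕ∞) ≤ lineTransversalHellyNumber d := by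
  obtain ⟨m, rfl⟩ : ∃ m, d = m + 1 := ⟨d - 1, by omega⟩
  obtain ⟨F, hfin, hballs, hno, hsub⟩ :=
    exists_unitBallFamily_without_transversal (m := m) (by omega)
  rw [show 2 * (m + 1) - 2 = 2 * m by omega, show 2 * (m + 1) - 1 = 2 * m + 1 by omega]
  refine ⟨⟨1, F, one_pos, hfin, hballs, hno, hsub⟩, le_sInf fun h hh => ?_⟩
  by_contra! hlt
  rw [Nat.cast_add, Nat.cast_one] at hlt
  exact hno (hh F hballs fun G hG hcard =>
    hsub G hG (hcard.trans (Order.le_of_lt_add_one hlt)))
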